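/- **Definitions.** For a Boolean algebra $B$, $\mathrm{Sub}(B)$ is the set of Boolean subalgebras of $B$ ordered by inclusion. A *Boolean domain* is an algebraic (complete) lattice $X$ such that for each compact $x\in X$ the principal ideal ${\downarrow}x$ is isomorphic to the lattice of partitions of a finite set, with coarser partitions below finer ones. An element $x$ of a lattice is *dual modular* if $(x\vee y)\wedge z=x\vee(y\wedge z)$ for all $y$ and all $z\ge x$, and $(w\vee x)\wedge y=w\vee(x\wedge y)$ for all $w\le y$. An element is *basic* if it is an atom or the least element $\bot$. A *principal pair* of a lattice with least element $\bot$ and greatest element $\top$ is an ordered pair $(y,z)$ of dual modular elements such that (i) $y=\top$ and $z$ is basic, or (ii) $z=\top$ and $y$ is basic, or (iii) $y\vee z=\top$ and $y\wedge z$ is basic and not dual modular; it is a principal pair *for* $x=y\wedge z$. $\mathrm{Dir}(X)$ is the set of principal pairs of $X$, with $(y,z)'=(z,y)$ and with $(y_1,z_1)\le(y_2,z_2)$ iff $y_1\le y_2$, $z_1\ge z_2$ and, if $y_1\wedge z_1$ is a dual modular atom, $(y_2,z_2)\ne(z_1,y_1)$. A *direction* of $X$ is a map $d\colon{\uparrow}x\to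 X^2$, for some basic $x\in X$, such that for all $y,z\ge x$: $d(y)$ is a principal pair for $x$ in the lattice ${\downarrow}y$; and if $y\le z$ and $d(z)=(v,w)$ then $d(y)=(y\wedge v,y\wedge w)$. $\mathrm{oDir}(X)$ is the set of directions of $X$, where $d'$ has the same domain as $d$ and $d'(y)$ is $d(y)$ with its components exchanged, and $d\le e$ iff $d(\top)\le e(\top)$ in $\mathrm{Dir}(X)$. **Theorem.** Let $B$ be a Boolean algebra with more than $4$ elements and $X$ a Boolean domain with more than $2$ elements. Then: 1. $\mathrm{Sub}(B)$ is a Boolean domain; 2. $\mathrm{Dir}(X)$ and $\mathrm{oDir}(X)$, each with the given $\le$ as its order and the given $'$ as its complement, are Boolean algebras; 3. $B\cong\mathrm{Dir}(\mathrm{Sub}(B))$ and $B\cong\mathrm{oDir}(\mathrm{Sub}(B))$, by bijections that preserve and reflect $\le$ and preserve $'$; 4. $X\cong\mathrm{Sub}(\mathrm{Dir}(X))$ and $X\cong\mathrm{Sub}(\mathrm{oDir}(X))$ as ordered sets; 5. $d\mapsto d(\top)$ is a bijection $\mathrm{oDir}(X)\to\mathrm{Dir}(X)$ that preserves and reflects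 $\le$ and preserves $'$. -/

import Mathlib

universe u v

namespace BooleanDomain

/-- A Boolean domain: an algebraic lattice in which the principal ideal of each compact element is
a finite partition lattice. The partitions of a set are ordered so that the coarser partition is
the smaller one (the order dual of the order on `Setoid.Partitions`): a subalgebra of a finite
Boolean algebra corresponds to a partition of the set of atoms, and larger subalgebras give finer
partitions. -/
structure IsBooleanDomain (X : Type v) [CompleteLattice X] : Prop where
  algebraic : IsCompactlyGenerated X
  partition : ∀ x : X, IsCompactElement x →
    ∃ n : ℕ, Nonempty (Set.Iic x ≃o (Setoid.Partitions (Fin n))ᵒᵈ)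

/-- Dual modular elements of a lattice. -/
def IsDualModular {L : Type v} [Lattice L] (x : L) : Prop :=
  (∀ y z : L, x ≤ z → (x ⊔ y) ⊓ z = x ⊔ (y ⊓ z)) ∧
  (∀ w y : L, w ≤ y → (w ⊔ x) ⊓ y = w ⊔ (x ⊓ y))

/-- Basic elements: the least element and the atoms. -/
def IsBasic {L : Type v} [PartialOrder L] [OrderBot L] (x : L) : Prop :=
  x = ⊥ ∨ IsAtom x

/-- `(y, z)` is a principal pair. -/
def IsPrincipalPair {L : Type v} [Lattice L] [BoundedOrder L] (y z : L) : Prop :=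
  IsDualModular y ∧ IsDualModular z ∧
    ((y = ⊤ ∧ IsBasic z) ∨ (z = ⊤ ∧ IsBasic y) ∨
      (y ⊔ z = ⊤ ∧ IsBasic (y ⊓ z) ∧ ¬ IsDualModular (y ⊓ z)))

/-- `(y, z)` is a principal pair for the element `x`. -/
def IsPrincipalPairFor {L : Type v} [Lattice L] [BoundedOrder L] (x y z : L) : Prop :=
  IsPrincipalPair y z ∧ y ⊓ z = x

/-- `Dir X`: the set of principal pairs of `X`. -/
@[ext]
structure Dir (X : Type v) [Lattice X] [BoundedOrder X] where
  fst : X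
  snd : X
  isPrincipalPair : IsPrincipalPair fst snd

theorem IsPrincipalPair.symm {L : Type v} [Lattice L] [BoundedOrder L] {y z : L}
    (h : IsPrincipalPair y z) : IsPrincipalPair z y := by
  obtain ⟨hy, hz, h⟩ := h
  refine ⟨hz, hy, ?_⟩
  rw [sup_comm z y, inf_comm z y]
  tauto

namespace Dir

variable {X : Type v} [Lattice X] [BoundedOrder X]

/-- The operation `(y, z)' = (z, y)` on `Dir X`. -/
def compl (p : Dir X) : Dir X :=
  ⟨p.snd, p.fst, p.isPrincipalPair.symm⟩

/-- The order on `Dir X`. -/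
def le (p q : Dir X) : Prop :=
  p.fst ≤ q.fst ∧ q.snd ≤ p.snd ∧
    (IsDualModular (p.fst ⊓ p.snd) ∧ IsAtom (p.fst ⊓ p.snd) →
      ¬ (q.fst = p.snd ∧ q.snd = p.fst))

end Dir

/-- `ODir X`: the set of directions of `X`. A direction for the basic element `base` is a map
`d` from the principal filter of `base` to `X × X`, such that each `d y` is a principal pair for
`base` in the lattice of elements below `y`, compatibly with the passage to smaller `y`. -/
@[ext]
structure ODir (X : Type v) [Lattice X] [BoundedOrder X] where
  base : X
  isBasic_base : IsBasic base
  toFun : Set.Ici base → X × X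
  isPrincipalPair : ∀ y : Set.Ici base, ∃ s t : Set.Iic (y : X),
    toFun y = ((s : X), (t : X)) ∧
      IsPrincipalPairFor (⟨(base : X), y.2⟩ : Set.Iic (y : X)) s t
  compat : ∀ y z : Set.Ici base, y ≤ z →
    toFun y = ((y : X) ⊓ (toFun z).1, (y : X) ⊓ (toFun z).2)

theorem isDualModular_of_Iic_top {X : Type v} [Lattice X] [BoundedOrder X]
    {s : Set.Iic (⊤ : X)} (h : IsDualModular s) : IsDualModular (s : X) := by
  refine ⟨fun y z hz => ?_, fun w y hw => ?_⟩
  · exact congrArg Subtype.val (h.1 ⟨y, le_top⟩ ⟨z, le_top⟩ hz)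
  · exact congrArg Subtype.val (h.2 ⟨w, le_top⟩ ⟨y, le_top⟩ hw)

theorem isDualModular_to_Iic_top {X : Type v} [Lattice X] [BoundedOrder X]
    {s : Set.Iic (⊤ : X)} (h : IsDualModular (s : X)) : IsDualModular s := by
  refine ⟨fun y z hz => Subtype.ext ?_, fun w y hw => Subtype.ext ?_⟩
  · exact h.1 y z hz
  · exact h.2 w y hw

theorem isBasic_of_Iic_top {X : Type v} [Lattice X] [BoundedOrder X]
    {s : Set.Iic (⊤ : X)} (h : IsBasic s) : IsBasic (s : X) := by
  rcases h with h | h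
  · exact Or.inl (congrArg Subtype.val h)
  · refine Or.inr ⟨fun hs => h.1 (Subtype.ext hs), fun b hb => ?_⟩
    exact congrArg Subtype.val (h.2 ⟨b, le_top⟩ hb)

theorem isPrincipalPair_of_Iic_top {X : Type v} [Lattice X] [BoundedOrder X]
    {s t : Set.Iic (⊤ : X)} (h : IsPrincipalPair s t) : IsPrincipalPair (s : X) (t : X) := by
  obtain ⟨hs, ht, h⟩ := h
  refine ⟨isDualModular_of_Iic_top hs, isDualModular_of_Iic_top ht, ?_⟩
  rcases h with ⟨h1, h2⟩ | ⟨h1, h2⟩ | ⟨h1, h2, h3⟩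
  · exact Or.inl ⟨congrArg Subtype.val h1, isBasic_of_Iic_top h2⟩
  · exact Or.inr (Or.inl ⟨congrArg Subtype.val h1, isBasic_of_Iic_top h2⟩)
  · exact Or.inr (Or.inr ⟨congrArg Subtype.val h1, isBasic_of_Iic_top h2,
      fun h => h3 (isDualModular_to_Iic_top (s := s ⊓ t) h)⟩)

namespace ODir

variable {X : Type v} [Lattice X] [BoundedOrder X]

/-- The operation on directions that swaps the components of every value. -/
def compl (d : ODir X) : ODir X where
  base := d.base
  isBasic_base := d.isBasic_base
  toFun y := (d.toFun y).swap
  isPrincipalPair y := by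
    obtain ⟨s, t, h, hp, hx⟩ := d.isPrincipalPair y
    exact ⟨t, s, by rw [h]; rfl, hp.symm, by rw [inf_comm, hx]⟩
  compat y z hyz := by
    rw [d.compat y z hyz]; rfl

/-- The principal pair `d(⊤)` of `X` determined by a direction `d`. -/
def atTop (d : ODir X) : Dir X where
  fst := (d.toFun ⟨⊤, le_top⟩).1
  snd := (d.toFun ⟨⊤, le_top⟩).2
  isPrincipalPair := by
    obtain ⟨s, t, h, hp, -⟩ := d.isPrincipalPair ⟨⊤, le_top⟩
    rw [h]
    exact isPrincipalPair_of_Iic_top hp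

/-- The order on `ODir X`. -/
def le (d e : ODir X) : Prop :=
  d.atTop.le e.atTop

end ODir

end BooleanDomain

/-! The elements of B can be recognized inside Sub(B). To b belongs the subalgebra `principal b`,
formed by the ideal below b and the complements of its elements. It is dual modular
(`isDualModular_principal`), and `IsDualModular.le_mem_or` is a strong enough converse: with each
element a, a dual modular subalgebra contains the whole ideal below a or the whole ideal below aᶜ.
Hence the principal pairs of Sub(B) are exactly the pairs (`principal b`, `principal bᶜ`). If B has
more than four elements they determine b, and the extra clause in the order of Dir repairs the one
failure of the componentwise order, at atoms (`le_iff_toDir_le`).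

So an isomorphism Sub(B) ≅ Sub(C) is induced by an isomorphism B ≅ C, and only by one
(`eq_of_forall_mem_gen`). In a Boolean domain X the ideal below a compact element is Sub of a finite
power set. For nonbasic compact elements, the inclusions between these ideals lift uniquely to
embeddings of the power sets; by uniqueness these form a directed system, and X is Sub of its limit
(`IsBooleanDomain.exists_orderIso_subalgebra`). This reduces the claims about X to lattices Sub(B).

Directions carry no more data than principal pairs: compatibility makes d(⊤) determine d, and each
principal pair restricts to a direction (`isPrincipalPairFor_inf`). -/

namespace BooleanDomain

/-! ### Dual modular subalgebras and principal pairs of Sub(B) -/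

section Subalgebra

variable {B : Type*} [BooleanAlgebra B]

theorem compl_inf_congr {a b p : B} (h : a ⊓ p = b ⊓ p) : aᶜ ⊓ p = bᶜ ⊓ p := by
  have key : ∀ c : B, cᶜ ⊓ p = p \ (c ⊓ p) := fun c => by
    rw [sdiff_inf_self_right, sdiff_eq, inf_comm]
  rw [key, key, h]

/-- A subset containing `⊥` and closed under joins and complements, as a Boolean subalgebra. -/
def subalgebraOfSupCompl (s : Set B) (bot : ⊥ ∈ s) (sup : ∀ a ∈ s, ∀ b ∈ s, a ⊔ b ∈ s)
    (compl : ∀ a ∈ s, aᶜ ∈ s) : BooleanSubalgebra B where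
  carrier := s
  supClosed' a ha b hb := sup a ha b hb
  infClosed' a ha b hb := by
    have h := compl _ (sup _ (compl a ha) _ (compl b hb))
    rwa [compl_sup, compl_compl, compl_compl] at h
  compl_mem' ha := compl _ ha
  bot_mem' := bot

/-- The subalgebra consisting of the ideal below `b` and the complements of its elements. -/
def principal (b : B) : BooleanSubalgebra B :=
  subalgebraOfSupCompl {c | c ≤ b ∨ bᶜ ≤ c} (Or.inl bot_le)
    (by
      rintro x (hx | hx) y (hy | hy)
      · exact Or.inl (sup_le hx hy)
      · exact Or.inr (hy.trans le_sup_right)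
      · exact Or.inr (hx.trans le_sup_left)
      · exact Or.inr (hx.trans le_sup_left))
    (by
      rintro x (hx | hx)
      · exact Or.inr (compl_le_compl hx)
      · exact Or.inl (compl_le_of_compl_le hx))

theorem mem_principal {b c : B} : c ∈ principal b ↔ c ≤ b ∨ bᶜ ≤ c := Iff.rfl

/-- The subalgebra generated by `b`. -/
def gen (b : B) : BooleanSubalgebra B :=
  subalgebraOfSupCompl {c | c = ⊥ ∨ c = b ∨ c = bᶜ ∨ c = ⊤} (Or.inl rfl)
    (by
      rintro x (rfl | rfl | rfl | rfl) y (rfl | rfl | rfl | rfl) <;> simp)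
    (by
      rintro x (rfl | rfl | rfl | rfl) <;> simp)

theorem mem_gen {b c : B} : c ∈ gen b ↔ c = ⊥ ∨ c = b ∨ c = bᶜ ∨ c = ⊤ := Iff.rfl

theorem self_mem_gen (b : B) : b ∈ gen b := Or.inr (Or.inl rfl)

theorem gen_le_iff {b : B} {S : BooleanSubalgebra B} : gen b ≤ S ↔ b ∈ S := by
  refine ⟨fun h => h (self_mem_gen b), fun h => ?_⟩
  rintro c (rfl | rfl | rfl | rfl)
  · exact S.bot_mem
  · exact h
  · exact S.compl_mem h
  · exact S.top_mem

theorem gen_compl (b : B) : gen bᶜ = gen b :=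
  le_antisymm (gen_le_iff.2 (BooleanSubalgebra.compl_mem (self_mem_gen b)))
    (gen_le_iff.2 (by simpa using BooleanSubalgebra.compl_mem (self_mem_gen bᶜ)))

theorem gen_eq_bot_iff {b : B} : gen b = ⊥ ↔ b = ⊥ ∨ b = ⊤ := by
  rw [← le_bot_iff, gen_le_iff, BooleanSubalgebra.mem_bot]

/-- The subalgebra generated by a subalgebra and one more element. -/
def adjoin (S : BooleanSubalgebra B) (p : B) : BooleanSubalgebra B :=
  subalgebraOfSupCompl {c | ∃ m ∈ S, ∃ n ∈ S, c ⊓ p = m ⊓ p ∧ c ⊓ pᶜ = n ⊓ pᶜ}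
    ⟨⊥, S.bot_mem, ⊥, S.bot_mem, rfl, rfl⟩
    (by
      rintro x ⟨m, hm, n, hn, h1, h2⟩ y ⟨m', hm', n', hn', h1', h2'⟩
      exact ⟨m ⊔ m', S.sup_mem hm hm', n ⊔ n', S.sup_mem hn hn',
        by rw [inf_sup_right, inf_sup_right, h1, h1'], by rw [inf_sup_right, inf_sup_right, h2, h2']⟩)
    (by
      rintro x ⟨m, hm, n, hn, h1, h2⟩
      exact ⟨mᶜ, S.compl_mem hm, nᶜ, S.compl_mem hn, compl_inf_congr h1, compl_inf_congr h2⟩)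

theorem le_adjoin (S : BooleanSubalgebra B) (p : B) : S ≤ adjoin S p :=
  fun c hc => ⟨c, hc, c, hc, rfl, rfl⟩

theorem self_mem_adjoin (S : BooleanSubalgebra B) (p : B) : p ∈ adjoin S p :=
  ⟨⊤, S.top_mem, ⊥, S.bot_mem, by simp, by simp⟩

theorem adjoin_finite {S : BooleanSubalgebra B} (hS : (S : Set B).Finite) (p : B) :
    (adjoin S p : Set B).Finite := by
  refine ((hS.prod hS).image fun x : B × B => x.1 ⊓ p ⊔ x.2 ⊓ pᶜ).subset ?_
  rintro c ⟨m, hm, n, hn, h1, h2⟩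
  exact ⟨(m, n), ⟨hm, hn⟩, by dsimp only; rw [← h1, ← h2, sup_inf_inf_compl]⟩

/-- On bᶜ every element of `principal b` is trivial, so joining it to Y frees the part below b and
leaves the traces on bᶜ unchanged. -/
theorem mem_principal_sup {b c : B} {Y : BooleanSubalgebra B} :
    c ∈ principal b ⊔ Y ↔ ∃ y ∈ Y, c ⊓ bᶜ = y ⊓ bᶜ := by
  constructor
  · intro h
    let T : BooleanSubalgebra B := subalgebraOfSupCompl {c | ∃ y ∈ Y, c ⊓ bᶜ = y ⊓ bᶜ}
      ⟨⊥, Y.bot_mem, rfl⟩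
      (by
        rintro x ⟨m, hm, h1⟩ y ⟨m', hm', h1'⟩
        exact ⟨m ⊔ m', Y.sup_mem hm hm', by rw [inf_sup_right, inf_sup_right, h1, h1']⟩)
      (by
        rintro x ⟨m, hm, h1⟩
        exact ⟨mᶜ, Y.compl_mem hm, compl_inf_congr h1⟩)
    have hP : principal b ≤ T := by
      rintro x (hx | hx)
      · exact ⟨⊥, Y.bot_mem, by
          rw [bot_inf_eq]; exact (disjoint_compl_right.mono_left hx).eq_bot⟩
      · exact ⟨⊤, Y.top_mem, by rw [top_inf_eq]; exact inf_eq_right.2 hx⟩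
    have hY : Y ≤ T := fun x hx => ⟨x, hx, rfl⟩
    exact sup_le hP hY h
  · rintro ⟨y, hy, h⟩
    rw [← sup_inf_inf_compl (x := c) (y := b), h]
    refine BooleanSubalgebra.sup_mem ?_ (BooleanSubalgebra.inf_mem ?_ ?_)
    · exact (le_sup_left : principal b ≤ _) (Or.inl inf_le_right)
    · exact (le_sup_right : Y ≤ _) hy
    · exact (le_sup_left : principal b ≤ _) (Or.inr le_rfl)

theorem isDualModular_principal (b : B) : IsDualModular (principal b) := by
  constructor
  · intro Y Z hZ
    refine le_antisymm ?_ (le_inf (sup_le_sup_left inf_le_left _) (sup_le hZ inf_le_right))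
    rintro c ⟨hc, hcZ⟩
    obtain ⟨y, hy, h⟩ := mem_principal_sup.1 hc
    refine mem_principal_sup.2 ⟨y, ⟨hy, ?_⟩, h⟩
    change y ∈ Z
    -- Z contains the ideal below b, and y differs from c only there.
    rw [← sup_inf_inf_compl (x := y) (y := b), ← h]
    exact Z.sup_mem (hZ (Or.inl inf_le_right)) (Z.inf_mem hcZ (hZ (Or.inr le_rfl)))
  · intro W Y hW
    refine le_antisymm ?_ (le_inf (sup_le_sup_left inf_le_left _) (sup_le hW inf_le_right))
    rintro c ⟨hc, hcY⟩
    change c ∈ Y at hcY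
    obtain ⟨w, hw, h⟩ := mem_principal_sup.1 (sup_comm W (principal b) ▸ hc)
    have h1 : c \ w ∈ principal b ⊓ Y := by
      refine ⟨Or.inl ?_, BooleanSubalgebra.sdiff_mem hcY (hW hw)⟩
      rw [sdiff_le_iff, ← compl_compl b, ← himp_eq, le_himp_iff, h]
      exact inf_le_left
    have h2 : w \ c ∈ principal b ⊓ Y := by
      refine ⟨Or.inl ?_, BooleanSubalgebra.sdiff_mem (hW hw) hcY⟩
      rw [sdiff_le_iff, ← compl_compl b, ← himp_eq, le_himp_iff, ← h]
      exact inf_le_left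
    -- c and w agree outside b, so both differences lie below b, and c is recovered from w by
    -- correcting with them.
    have h3 : c = (w \ (w \ c)) ⊔ (c \ w) := by
      rw [sdiff_sdiff_right_self, inf_comm, sup_inf_sdiff]
    rw [h3]
    have hr := (le_sup_right : principal b ⊓ Y ≤ W ⊔ principal b ⊓ Y)
    exact BooleanSubalgebra.sup_mem (BooleanSubalgebra.sdiff_mem
      ((le_sup_left : W ≤ _) hw) (hr h2)) (hr h1)

/-- If p ≤ a and q ≤ aᶜ are both missing from M, the first modular law fails for `gen (p ⊔ q)` and
`adjoin M p`: they meet inside M, but p = (p ⊔ q) ⊓ a lies in M ⊔ `gen (p ⊔ q)`. -/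
theorem IsDualModular.le_mem_or {M : BooleanSubalgebra B} (hM : IsDualModular M) {a : B}
    (ha : a ∈ M) : (∀ p ≤ a, p ∈ M) ∨ (∀ q ≤ aᶜ, q ∈ M) := by
  by_contra! hcon
  obtain ⟨⟨p, hp, hpM⟩, q, hq, hqM⟩ := hcon
  have hpa : (p ⊔ q) ⊓ a = p := by
    rw [inf_sup_right, inf_eq_left.2 hp, (disjoint_compl_left.mono_left hq).eq_bot, sup_bot_eq]
  have hqa : (p ⊔ q) ⊓ aᶜ = q := by
    rw [inf_sup_right, inf_eq_left.2 hq, (disjoint_compl_right.mono_left hp).eq_bot, bot_sup_eq]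
  -- As p ≤ a, adjoining p creates no new traces on aᶜ, whereas the trace of p ⊔ q there is q.
  have hu : p ⊔ q ∉ adjoin M p := by
    intro hu
    have hqA : q ∈ adjoin M p :=
      hqa ▸ BooleanSubalgebra.inf_mem hu (BooleanSubalgebra.compl_mem (le_adjoin M p ha))
    obtain ⟨m, hm, n, hn, -, h⟩ := hqA
    apply hqM
    have h' : (q ⊓ pᶜ) ⊓ aᶜ = (n ⊓ pᶜ) ⊓ aᶜ := by rw [h]
    rw [inf_assoc, inf_assoc, inf_eq_right.2 (compl_le_compl hp), inf_eq_left.2 hq] at h'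
    rw [h']
    exact M.inf_mem hn (M.compl_mem ha)
  have hbot : gen (p ⊔ q) ⊓ adjoin M p ≤ M := by
    intro c hc
    obtain ⟨hc1, hc⟩ := BooleanSubalgebra.mem_inf.1 hc
    rcases mem_gen.1 hc1 with rfl | rfl | rfl | rfl
    · exact M.bot_mem
    · exact (hu hc).elim
    · exact (hu (BooleanSubalgebra.compl_mem_iff.1 hc)).elim
    · exact M.top_mem
  have h1 := hM.1 (gen (p ⊔ q)) (adjoin M p) (le_adjoin M p)
  rw [sup_eq_left.2 hbot] at h1
  apply hpM
  rw [← h1]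
  refine BooleanSubalgebra.mem_inf.2 ⟨?_, self_mem_adjoin M p⟩
  have h3 := BooleanSubalgebra.inf_mem
    ((le_sup_right : gen (p ⊔ q) ≤ M ⊔ gen (p ⊔ q)) (self_mem_gen (p ⊔ q)))
    ((le_sup_left : M ≤ M ⊔ gen (p ⊔ q)) ha)
  rwa [hpa] at h3

theorem principal_inf_principal_compl (b : B) : principal b ⊓ principal bᶜ = gen b := by
  refine le_antisymm ?_ (gen_le_iff.2 ⟨Or.inl le_rfl, Or.inr (compl_compl b).le⟩)
  rintro c ⟨h1 | h1, h2 | h2⟩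
  · exact Or.inl (le_bot_iff.1 ((le_inf h1 h2).trans inf_compl_eq_bot.le))
  · exact Or.inr (Or.inl (le_antisymm h1 ((compl_compl b).ge.trans h2)))
  · exact Or.inr (Or.inr (Or.inl (le_antisymm h2 h1)))
  · exact Or.inr (Or.inr (Or.inr (top_le_iff.1 ((compl_sup_eq_top (x := bᶜ)).ge.trans
      (sup_le h2 h1)))))

theorem principal_sup_principal_compl (b : B) : principal b ⊔ principal bᶜ = ⊤ := by
  refine top_le_iff.1 fun c _ => mem_principal_sup.2 ⟨c ⊓ bᶜ, Or.inl inf_le_right, ?_⟩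
  rw [inf_assoc, inf_idem]

theorem principal_bot : principal (⊥ : B) = ⊥ := by
  refine SetLike.ext fun c => ?_
  simp [mem_principal]

theorem principal_top : principal (⊤ : B) = ⊤ := by
  refine SetLike.ext fun c => ?_
  simp [mem_principal]

theorem principal_eq_gen_of_isAtom {b : B} (hb : IsAtom b) : principal b = gen b := by
  refine le_antisymm ?_ (gen_le_iff.2 (Or.inl le_rfl))
  rintro c (h | h)
  · rcases hb.le_iff.1 h with h | h
    · exact Or.inl h
    · exact Or.inr (Or.inl h)
  · rcases hb.le_iff.1 (compl_le_of_compl_le h) with h | h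
    · exact Or.inr (Or.inr (Or.inr (compl_eq_bot.1 h)))
    · exact Or.inr (Or.inr (Or.inl (by rw [← h, compl_compl])))

theorem principal_compl_of_isAtom {b : B} (hb : IsAtom b) : principal bᶜ = ⊤ := by
  refine top_le_iff.1 fun c _ => ?_
  rw [mem_principal, compl_compl]
  by_cases h : b ≤ c
  · exact Or.inr h
  · exact Or.inl (le_compl_iff_disjoint_left.2 (hb.not_le_iff_disjoint.1 h))

theorem isAtom_of_le_mem_gen {b : B} (hb : b ≠ ⊥) (h : ∀ p ≤ b, p ∈ gen b) : IsAtom b := by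
  refine ⟨hb, fun c hc => ?_⟩
  rcases h c hc.le with rfl | rfl | rfl | rfl
  · rfl
  · exact (lt_irrefl _ hc).elim
  · rw [compl_eq_bot]
    exact compl_le_self.1 hc.le
  · exact (not_top_lt hc).elim

theorem isDualModular_gen_of_isAtom {b : B} (hb : IsAtom b) : IsDualModular (gen b) :=
  principal_eq_gen_of_isAtom hb ▸ isDualModular_principal b

/-- This separates clause (iii) of principal pairs from the other two: `gen b` fails to be dual
modular when b is neither trivial nor an atom nor a coatom. -/
theorem isAtom_or_of_isDualModular_gen {b : B} (h0 : b ≠ ⊥) (h1 : b ≠ ⊤)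
    (h : IsDualModular (gen b)) : IsAtom b ∨ IsAtom bᶜ := by
  rcases h.le_mem_or (self_mem_gen b) with h | h
  · exact Or.inl (isAtom_of_le_mem_gen h0 h)
  · exact Or.inr (isAtom_of_le_mem_gen (by simpa using h1) (by rwa [gen_compl]))

theorem isAtom_gen {b : B} (h0 : b ≠ ⊥) (h1 : b ≠ ⊤) : IsAtom (gen b) := by
  refine ⟨fun h => ?_, fun S hS => ?_⟩
  · rcases gen_eq_bot_iff.1 h with h | h
    exacts [h0 h, h1 h]
  · refine le_bot_iff.1 fun c hc => ?_
    rcases hS.le hc with h | h | h | h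
    · exact Or.inl h
    · exact (hS.not_ge (gen_le_iff.2 (h ▸ hc))).elim
    · exact (hS.not_ge (gen_le_iff.2 (by simpa [h] using S.compl_mem hc))).elim
    · exact Or.inr h

theorem isBasic_gen (b : B) : IsBasic (gen b) := by
  by_cases h0 : b = ⊥
  · exact Or.inl (gen_eq_bot_iff.2 (Or.inl h0))
  by_cases h1 : b = ⊤
  · exact Or.inl (gen_eq_bot_iff.2 (Or.inr h1))
  exact Or.inr (isAtom_gen h0 h1)

theorem IsBasic.eq_gen {S : BooleanSubalgebra B} (hS : IsBasic S) {b : B} (hb : b ∈ S)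
    (h0 : b ≠ ⊥) (h1 : b ≠ ⊤) : S = gen b := by
  rcases hS with rfl | hS
  · rcases hb with h | h
    exacts [(h0 h).elim, (h1 h).elim]
  · refine ((hS.le_iff.1 (gen_le_iff.2 hb)).resolve_left fun h => ?_).symm
    rcases gen_eq_bot_iff.1 h with h | h
    exacts [h0 h, h1 h]

theorem isPrincipalPair_principal (b : B) : IsPrincipalPair (principal b) (principal bᶜ) := by
  refine ⟨isDualModular_principal b, isDualModular_principal _, ?_⟩
  by_cases h0 : b = ⊥
  · subst h0
    refine Or.inr (Or.inl ⟨by rw [compl_bot, principal_top], Or.inl principal_bot⟩)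
  by_cases h1 : b = ⊤
  · subst h1
    refine Or.inl ⟨principal_top, Or.inl (by rw [compl_top, principal_bot])⟩
  by_cases h2 : IsAtom b
  · exact Or.inr (Or.inl ⟨principal_compl_of_isAtom h2,
      principal_eq_gen_of_isAtom h2 ▸ isBasic_gen b⟩)
  by_cases h3 : IsAtom bᶜ
  · refine Or.inl ⟨?_, principal_eq_gen_of_isAtom h3 ▸ isBasic_gen bᶜ⟩
    rw [← compl_compl b, principal_compl_of_isAtom h3]
  · refine Or.inr (Or.inr ⟨principal_sup_principal_compl b, ?_, ?_⟩) <;>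
      rw [principal_inf_principal_compl]
    · exact isBasic_gen b
    · intro h
      rcases isAtom_or_of_isDualModular_gen h0 h1 h with h | h
      exacts [h2 h, h3 h]

theorem exists_eq_principal_of_eq_top {y z : BooleanSubalgebra B} (hz : IsDualModular z)
    (hy : y = ⊤) (hb : IsBasic z) : ∃ b, y = principal b ∧ z = principal bᶜ := by
  subst hy
  have key : ∀ a : B, IsAtom a → z = gen a → ∃ b, ⊤ = principal b ∧ z = principal bᶜ :=
    fun a ha h => ⟨aᶜ, (principal_compl_of_isAtom ha).symm, by
      rw [compl_compl, principal_eq_gen_of_isAtom ha, h]⟩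
  by_cases hbot : z ≤ ⊥
  · exact ⟨⊤, principal_top.symm, by rw [compl_top, principal_bot]; exact le_bot_iff.1 hbot⟩
  obtain ⟨c, hc, hc'⟩ := SetLike.not_le_iff_exists.1 hbot
  rw [BooleanSubalgebra.mem_bot, not_or] at hc'
  have hzc := hb.eq_gen hc hc'.1 hc'.2
  rcases isAtom_or_of_isDualModular_gen hc'.1 hc'.2 (hzc ▸ hz) with h | h
  · exact key c h hzc
  · exact key cᶜ h (by rw [gen_compl, hzc])

/-- If the ideal below d lies in y, then d ⊓ cᶜ lies in y ⊓ z = `gen c`, which forces d ≤ c: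
otherwise cᶜ ≤ d, so the ideal below cᶜ lies in `gen c`, cᶜ is an atom and `gen c` is dual modular.
Applying `IsDualModular.le_mem_or` to each element of y then finishes. -/
theorem eq_principal_of_le_mem {y z : BooleanSubalgebra B} {c : B} (hy : IsDualModular y)
    (hyz : y ⊓ z = gen c) (hnot : ¬ IsDualModular (gen c))
    (h1 : ∀ p ≤ c, p ∈ y) (h2 : ∀ p ≤ cᶜ, p ∈ z) : y = principal c := by
  have hc : c ≠ ⊥ := by
    rintro rfl
    rw [gen_eq_bot_iff.2 (Or.inl rfl), ← principal_bot] at hnot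
    exact hnot (isDualModular_principal ⊥)
  refine le_antisymm ?_ ?_
  · have key : ∀ d : B, (∀ p ≤ d, p ∈ y) → d ≤ c := by
      intro d hd
      have hm : d ⊓ cᶜ ∈ y ⊓ z := ⟨hd _ inf_le_left, h2 _ inf_le_right⟩
      rw [hyz, ← sdiff_eq] at hm
      rcases hm with h | h | h | h
      · exact sdiff_eq_bot_iff.1 h
      · exact (hc (le_compl_self.1 (h.symm.le.trans (sdiff_eq.le.trans inf_le_right)))).elim
      · have hcd : cᶜ ≤ d := h ▸ sdiff_le
        by_cases hc0 : cᶜ = ⊥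
        · rw [compl_eq_bot.1 hc0]; exact le_top
        have : IsAtom cᶜ := isAtom_of_le_mem_gen hc0 fun p hp => by
          rw [gen_compl, ← hyz]; exact ⟨hd p (hp.trans hcd), h2 p hp⟩
        exact (hnot (gen_compl c ▸ isDualModular_gen_of_isAtom this)).elim
      · have : ⊤ ≤ cᶜ := h ▸ sdiff_eq.le.trans inf_le_right
        exact (hc (compl_eq_top.1 (top_le_iff.1 this))).elim
    intro d hd
    rcases hy.le_mem_or hd with h | h
    · exact Or.inl (key d h)
    · exact Or.inr (compl_le_of_compl_le (key dᶜ h))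
  · rintro d (hd | hd)
    · exact h1 d hd
    · simpa using y.compl_mem (h1 dᶜ (compl_le_of_compl_le hd))

theorem IsPrincipalPair.exists_principal {y z : BooleanSubalgebra B} (h : IsPrincipalPair y z) :
    ∃ b, y = principal b ∧ z = principal bᶜ := by
  obtain ⟨hy, hz, ⟨h1, h2⟩ | ⟨h1, h2⟩ | ⟨-, hb, hnot⟩⟩ := h
  · exact exists_eq_principal_of_eq_top hz h1 h2
  · obtain ⟨b, h, h'⟩ := exists_eq_principal_of_eq_top hy h1 h2
    exact ⟨bᶜ, h', by rw [compl_compl, h]⟩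
  · have hbot : ¬ y ⊓ z ≤ ⊥ := fun h => hnot (by
      rw [le_bot_iff.1 h, ← principal_bot]; exact isDualModular_principal ⊥)
    obtain ⟨c, hc, hc'⟩ := SetLike.not_le_iff_exists.1 hbot
    rw [BooleanSubalgebra.mem_bot, not_or] at hc'
    have hyz := hb.eq_gen hc hc'.1 hc'.2
    rw [hyz] at hnot
    -- y and z cannot contain the ideal on the same side of c, for that side would be an atom and y
    -- ⊓ z dual modular.
    have hat : ∀ b : B, b ≠ ⊥ → gen b = gen c → (∀ p ≤ b, p ∈ y) → (∀ p ≤ b, p ∈ z) → False :=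
      fun b hb0 hg hby hbz => hnot (hg ▸ isDualModular_gen_of_isAtom
        (isAtom_of_le_mem_gen hb0 fun p hp => by rw [hg, ← hyz]; exact ⟨hby p hp, hbz p hp⟩))
    have hc1 : cᶜ ≠ ⊥ := by simpa using hc'.2
    rcases hy.le_mem_or hc.1 with h1 | h1 <;> rcases hz.le_mem_or hc.2 with h2 | h2
    · exact (hat c hc'.1 rfl h1 h2).elim
    · exact ⟨c, eq_principal_of_le_mem hy hyz hnot h1 h2,
        eq_principal_of_le_mem hz (by rw [gen_compl, inf_comm, hyz]) (by rwa [gen_compl]) h2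
          (by rwa [compl_compl])⟩
    · exact ⟨cᶜ, eq_principal_of_le_mem hy (by rw [gen_compl, hyz]) (by rwa [gen_compl]) h1
          (by rwa [compl_compl]), by
        rw [compl_compl]
        exact eq_principal_of_le_mem hz (by rw [inf_comm, hyz]) hnot h2 h1⟩
    · exact (hat cᶜ hc1 (gen_compl c) h1 h2).elim

end Subalgebra

/-! ### Invariance under lattice isomorphisms -/

section Transport

variable {L M : Type*} [Lattice L] [Lattice M]

theorem IsDualModular.map (e : L ≃o M) {x : L} (h : IsDualModular x) : IsDualModular (e x) := by
  constructor
  · intro y z hz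
    obtain ⟨y, rfl⟩ := e.surjective y
    obtain ⟨z, rfl⟩ := e.surjective z
    rw [← map_sup, ← map_inf, ← map_inf, ← map_sup, h.1 y z (e.le_iff_le.1 hz)]
  · intro y z hz
    obtain ⟨y, rfl⟩ := e.surjective y
    obtain ⟨z, rfl⟩ := e.surjective z
    rw [← map_sup, ← map_inf, ← map_inf, ← map_sup, h.2 y z (e.le_iff_le.1 hz)]

theorem isDualModular_map_iff (e : L ≃o M) {x : L} : IsDualModular (e x) ↔ IsDualModular x :=
  ⟨fun h => by simpa using h.map e.symm, fun h => h.map e⟩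

variable [BoundedOrder L] [BoundedOrder M]

theorem isBasic_map_iff (e : L ≃o M) {x : L} : IsBasic (e x) ↔ IsBasic x := by
  rw [IsBasic, IsBasic, e.isAtom_iff, map_eq_bot_iff]

theorem isPrincipalPair_map_iff (e : L ≃o M) {y z : L} :
    IsPrincipalPair (e y) (e z) ↔ IsPrincipalPair y z := by
  simp only [IsPrincipalPair, ← map_sup, ← map_inf, isDualModular_map_iff, isBasic_map_iff,
    map_eq_top_iff]

/-- An isomorphism of lattices induces a bijection between principal pairs. -/
def Dir.congr (e : L ≃o M) : Dir L ≃ Dir M where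
  toFun p := ⟨e p.fst, e p.snd, (isPrincipalPair_map_iff e).2 p.isPrincipalPair⟩
  invFun p := ⟨e.symm p.fst, e.symm p.snd, (isPrincipalPair_map_iff e.symm).2 p.isPrincipalPair⟩
  left_inv p := by simp
  right_inv p := by simp

theorem Dir.congr_le_iff (e : L ≃o M) {p q : Dir L} :
    (Dir.congr e p).le (Dir.congr e q) ↔ p.le q := by
  simp only [Dir.le, Dir.congr, Equiv.coe_fn_mk, ← map_inf, isDualModular_map_iff, e.isAtom_iff,
    e.le_iff_le, e.injective.eq_iff]

theorem Dir.congr_compl (e : L ≃o M) (p : Dir L) :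
    Dir.congr e p.compl = (Dir.congr e p).compl := rfl

end Transport

/-! ### The isomorphism from B to Dir(Sub(B)) -/

section Directions

variable {B : Type*} [BooleanAlgebra B]

theorem isBasic_top_of_gen_eq_top {b : B} (h : gen b = ⊤) :
    IsBasic (⊤ : BooleanSubalgebra B) := h ▸ isBasic_gen b

theorem encard_pair_le {α : Type*} (a b : α) : ({a, b} : Set α).encard ≤ 2 :=
  (Set.encard_insert_le _ _).trans (by rw [Set.encard_singleton]; norm_num)

/-- A basic top is generated by one element, so it has at most four. In this form the size
hypothesis passes through lattice isomorphisms. -/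
theorem not_isBasic_top_of_four_lt_card (hB : 4 < ENat.card B) :
    ¬ IsBasic (⊤ : BooleanSubalgebra B) := by
  intro h
  have hall : ∃ b : B, gen b = ⊤ := by
    by_cases hb : ∃ b : B, b ≠ ⊥ ∧ b ≠ ⊤
    · obtain ⟨b, h0, h1⟩ := hb
      exact ⟨b, (h.eq_gen BooleanSubalgebra.mem_top h0 h1).symm⟩
    · push Not at hb
      refine ⟨⊥, top_le_iff.1 fun c _ => ?_⟩
      by_cases hc : c = ⊥
      · exact Or.inl hc
      · exact Or.inr (Or.inr (Or.inr (hb c hc)))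
  obtain ⟨b, hb⟩ := hall
  refine hB.not_ge ?_
  rw [← Set.encard_univ]
  have hsub : (Set.univ : Set B) ⊆ {⊥, b, bᶜ, ⊤} := fun c _ => by
    have : c ∈ gen b := hb ▸ BooleanSubalgebra.mem_top
    exact this
  refine (Set.encard_le_encard hsub).trans ?_
  refine (Set.encard_insert_le _ _).trans ?_
  have h1 := Set.encard_insert_le {bᶜ, ⊤} b
  have h2 := encard_pair_le bᶜ ⊤
  calc Set.encard {b, bᶜ, ⊤} + 1 ≤ 2 + 1 + 1 := by gcongr; exact h1.trans (by gcongr)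
    _ = 4 := by norm_num

theorem not_isBasic_top_of_two_lt_card {X : Type*} [Lattice X] [BoundedOrder X]
    (hX : 2 < ENat.card X) : ¬ IsBasic (⊤ : X) := by
  intro h
  refine hX.not_ge ?_
  rw [← Set.encard_univ]
  refine (Set.encard_le_encard (t := {⊥, ⊤}) fun c _ => ?_).trans (encard_pair_le _ _)
  rcases h with h | h
  · exact Or.inl (le_bot_iff.1 (h ▸ le_top))
  · exact h.le_iff.1 le_top

theorem principal_mono {a b : B} (h : a ≤ b) : principal a ≤ principal b := by
  rintro c (hc | hc)
  · exact Or.inl (hc.trans h)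
  · exact Or.inr ((compl_le_compl h).trans hc)

/-- The principal pair of subalgebras determined by an element. -/
def toDir (b : B) : Dir (BooleanSubalgebra B) :=
  ⟨principal b, principal bᶜ, isPrincipalPair_principal b⟩

theorem toDir_surjective : Function.Surjective (toDir (B := B)) := by
  intro p
  obtain ⟨b, h, h'⟩ := p.isPrincipalPair.exists_principal
  exact ⟨b, Dir.ext h.symm h'.symm⟩

theorem toDir_compl (b : B) : toDir bᶜ = (toDir b).compl :=
  Dir.ext rfl (congrArg principal (compl_compl b))

/-- The componentwise order without a ≤ b forces b = aᶜ with a an atom. There `principal aᶜ` = ⊤, so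
the pair of a lies componentwise below its swap; the third clause of the order removes this case. -/
theorem le_iff_toDir_le (hB : ¬ IsBasic (⊤ : BooleanSubalgebra B)) {a b : B} :
    a ≤ b ↔ (toDir a).le (toDir b) := by
  constructor
  · intro hab
    refine ⟨principal_mono hab, principal_mono (compl_le_compl hab), ?_⟩
    rintro ⟨hd, hat⟩ ⟨h1, h2⟩
    change principal b = principal aᶜ at h1
    change principal bᶜ = principal a at h2
    change IsDualModular (principal a ⊓ principal aᶜ) at hd
    change IsAtom (principal a ⊓ principal aᶜ) at hat
    have hg : gen b = gen a := by
      rw [← principal_inf_principal_compl, ← principal_inf_principal_compl, h1, h2, inf_comm]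
    rw [principal_inf_principal_compl] at hd hat
    have ha : ¬ (a = ⊥ ∨ a = ⊤) := fun h => hat.1 (gen_eq_bot_iff.2 h)
    rw [not_or] at ha
    have hb : b ∈ gen a := hg ▸ self_mem_gen b
    rcases hb with h | h | h | h
    · exact ha.1 (le_bot_iff.1 (h ▸ hab))
    -- Now b and bᶜ have the same principal subalgebra, equal to `gen b`. One of them is an atom, so
    -- this subalgebra is ⊤, against the size of B.
    · subst h
      apply hB
      refine isBasic_top_of_gen_eq_top (b := b) ?_
      rw [← principal_inf_principal_compl, ← h1, inf_idem]
      rcases isAtom_or_of_isDualModular_gen ha.1 ha.2 hd with h | h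
      · rw [h1, principal_compl_of_isAtom h]
      · rw [← compl_compl b, principal_compl_of_isAtom h]
    · exact ha.1 (le_compl_self.1 (h ▸ hab))
    · refine hat.1 ?_
      rw [← hg]
      exact gen_eq_bot_iff.2 (Or.inr h)
  · rintro ⟨h1, h2, h3⟩
    by_contra hab
    have hba : b = aᶜ := by
      refine le_antisymm ?_ (compl_le_of_compl_le ?_)
      · exact (h2 (Or.inr (compl_compl b).le : b ∈ principal bᶜ)).resolve_right
          fun h => hab ((compl_compl a).ge.trans h)
      · exact (h1 (Or.inl le_rfl : a ∈ principal a)).resolve_left hab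
    subst hba
    have ha0 : a ≠ ⊥ := fun h => hab (h ▸ bot_le)
    have hat : IsAtom a := by
      refine ⟨ha0, fun c hc => ?_⟩
      rcases h1 (Or.inl hc.le : c ∈ principal a) with h | h
      · exact le_bot_iff.1 ((le_inf hc.le h).trans inf_compl_eq_bot.le)
      · exact (hc.not_ge ((compl_compl a).ge.trans h)).elim
    have ha1 : a ≠ ⊤ := by
      rintro rfl
      have h := principal_compl_of_isAtom hat
      rw [compl_top, principal_bot] at h
      exact hB (Or.inl h.symm)
    refine h3 ?_ ⟨rfl, congrArg principal (compl_compl a)⟩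
    change IsDualModular (principal a ⊓ principal aᶜ) ∧ IsAtom (principal a ⊓ principal aᶜ)
    rw [principal_inf_principal_compl]
    exact ⟨isDualModular_gen_of_isAtom hat, isAtom_gen ha0 ha1⟩

theorem toDir_injective (hB : ¬ IsBasic (⊤ : BooleanSubalgebra B)) :
    Function.Injective (toDir (B := B)) := fun _ _ h =>
  le_antisymm ((le_iff_toDir_le hB).2 (h ▸ (le_iff_toDir_le hB).1 le_rfl))
    ((le_iff_toDir_le hB).2 (h ▸ (le_iff_toDir_le hB).1 le_rfl))

/-- The elements of a Boolean algebra with more than four elements are the principal pairs of its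
lattice of subalgebras. -/
noncomputable def equivDir (hB : ¬ IsBasic (⊤ : BooleanSubalgebra B)) :
    B ≃ Dir (BooleanSubalgebra B) :=
  Equiv.ofBijective toDir ⟨toDir_injective hB, toDir_surjective⟩

end Directions

/-! ### Isomorphisms of subalgebra lattices come from unique embeddings -/

section Rigidity

variable {B C : Type*} [BooleanAlgebra B] [BooleanAlgebra C]

/-- The subalgebras of a subalgebra `T` are the subalgebras below `T`. -/
def subalgebraIicIso (T : BooleanSubalgebra B) : BooleanSubalgebra T ≃o Set.Iic T where
  toFun S := ⟨S.map T.subtype, by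
    rintro _ ⟨a, -, rfl⟩
    exact a.2⟩
  invFun S := (S : BooleanSubalgebra B).comap T.subtype
  left_inv S := SetLike.ext fun a =>
    BooleanSubalgebra.apply_mem_map_iff T.subtype_injective
  right_inv S := Subtype.ext <| SetLike.ext fun a => by
    constructor
    · rintro ⟨b, hb, rfl⟩
      exact hb
    · exact fun ha => ⟨⟨a, S.2 ha⟩, ha, rfl⟩
  map_rel_iff' {S S'} := ⟨fun h a ha =>
    (BooleanSubalgebra.apply_mem_map_iff T.subtype_injective).1
      (h ((BooleanSubalgebra.apply_mem_map_iff T.subtype_injective).2 ha)),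
    fun h => BooleanSubalgebra.map_mono h⟩

theorem coe_mem_subalgebraIicIso {T : BooleanSubalgebra B} {S : BooleanSubalgebra T} {a : T} :
    (a : B) ∈ (subalgebraIicIso T S : BooleanSubalgebra B) ↔ a ∈ S :=
  BooleanSubalgebra.apply_mem_map_iff T.subtype_injective

/-- Isomorphic Boolean algebras have isomorphic lattices of subalgebras. -/
def subalgebraCongr (e : B ≃o C) : BooleanSubalgebra B ≃o BooleanSubalgebra C where
  toFun S := S.comap (e.symm : BoundedLatticeHom C B)
  invFun S := S.comap (e : BoundedLatticeHom B C)
  left_inv S := SetLike.ext fun a => by simp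
  right_inv S := SetLike.ext fun a => by simp
  map_rel_iff' {S S'} := ⟨fun h a ha => by
    have := @h (e a) (by simpa using ha)
    simpa using this, fun h => BooleanSubalgebra.comap_mono h⟩

/-- e acts on principal pairs, hence on elements. It respects membership because `gen b` is the meet
of the pair of b. -/
theorem exists_orderIso_of_subalgebraIso (hB : ¬ IsBasic (⊤ : BooleanSubalgebra B))
    (e : BooleanSubalgebra B ≃o BooleanSubalgebra C) :
    ∃ h : B ≃o C, ∀ (S : BooleanSubalgebra B) (b : B), h b ∈ e S ↔ b ∈ S := by
  have hC : ¬ IsBasic (⊤ : BooleanSubalgebra C) := by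
    rwa [← map_top e, isBasic_map_iff]
  let h : B ≃ C := (equivDir hB).trans ((Dir.congr e).trans (equivDir hC).symm)
  have hd : ∀ b, toDir (h b) = Dir.congr e (toDir b) := fun b =>
    (equivDir hC).apply_symm_apply _
  have hg : ∀ b, gen (h b) = e (gen b) := fun b => by
    rw [← principal_inf_principal_compl, ← principal_inf_principal_compl, map_inf]
    exact congrArg₂ (· ⊓ ·) (congrArg Dir.fst (hd b)) (congrArg Dir.snd (hd b))
  refine ⟨⟨h, fun {a b} => ?_⟩, fun S b => ?_⟩
  · rw [le_iff_toDir_le hC, hd, hd, Dir.congr_le_iff, ← le_iff_toDir_le hB]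
  · rw [← gen_le_iff, ← gen_le_iff (S := S), ← e.le_iff_le, ← hg]
    rfl

theorem exists_hom_of_subalgebraIso (hB : ¬ IsBasic (⊤ : BooleanSubalgebra B))
    {T : BooleanSubalgebra C} (e : BooleanSubalgebra B ≃o Set.Iic T) :
    ∃ f : BoundedLatticeHom B C, Function.Injective f ∧ Set.range f = T ∧
      ∀ (S : BooleanSubalgebra B) (b : B), f b ∈ (e S : BooleanSubalgebra C) ↔ b ∈ S := by
  obtain ⟨h, hh⟩ := exists_orderIso_of_subalgebraIso hB (e.trans (subalgebraIicIso T).symm)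
  refine ⟨T.subtype.comp (h : BoundedLatticeHom B T),
    T.subtype_injective.comp h.injective, ?_, fun S b => ?_⟩
  · ext c
    constructor
    · rintro ⟨b, rfl⟩
      exact (h b).2
    · intro hc
      exact ⟨h.symm ⟨c, hc⟩, by simp⟩
  · rw [← hh S b, ← coe_mem_subalgebraIicIso]
    simp

/-- Each f b is g b or its complement. Where it is the complement and b ≠ ⊥, comparing values below
b shows that b is an atom; the same holds for bᶜ, so B would have only four elements. On four
elements, exchanging the atoms is a genuine exception. -/
theorem eq_of_forall_mem_gen (hB : ¬ IsBasic (⊤ : BooleanSubalgebra B))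
    {f g : BoundedLatticeHom B C} (hf : Function.Injective f) (hg : Function.Injective g)
    (h : ∀ b, ∃ c ∈ gen b, f b = g c) : f = g := by
  have hfg : ∀ b, f b = g b ∨ f b = (g b)ᶜ := by
    intro b
    obtain ⟨c, rfl | rfl | rfl | rfl, hc⟩ := h b
    · rw [map_bot, ← map_bot f, hf.eq_iff] at hc
      left; rw [hc, map_bot, map_bot]
    · exact Or.inl hc
    · right; rw [hc, map_compl']
    · rw [map_top, ← map_top f, hf.eq_iff] at hc
      left; rw [hc, map_top, map_top]
  have hat : ∀ b, b ≠ ⊥ → f b = (g b)ᶜ → IsAtom b := by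
    intro b hb0 hb
    refine ⟨hb0, fun c hc => ?_⟩
    have hle : f c ≤ (g b)ᶜ := hb ▸ OrderHomClass.mono f hc.le
    rcases hfg c with h | h
    · have h0 : g c ≤ g b ⊓ (g b)ᶜ := le_inf (OrderHomClass.mono g hc.le) (h ▸ hle)
      rw [inf_compl_eq_bot, le_bot_iff, ← map_bot g] at h0
      exact hg h0
    · have h0 : g b ≤ g c := compl_le_compl_iff_le.1 (h ▸ hle)
      exact absurd (hg (le_antisymm h0 (OrderHomClass.mono g hc.le))) hc.ne'
  ext b
  rcases hfg b with h | h
  · exact h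
  · by_cases h0 : b = ⊥
    · rw [h0, map_bot, map_bot]
    by_cases h1 : b = ⊤
    · rw [h1, map_top, map_top]
    have ha := hat b h0 h
    have ha' := hat bᶜ (by simpa using h1) (by rw [map_compl', map_compl', h])
    refine (hB (isBasic_top_of_gen_eq_top (b := b) ?_)).elim
    rw [← gen_compl, ← principal_eq_gen_of_isAtom ha', principal_compl_of_isAtom ha]

end Rigidity

/-! ### Finite subalgebras, partitions, and Sub(B) as a Boolean domain -/

section Finite

variable {B : Type*} [BooleanAlgebra B]

/-- Finer partitions of a finite set correspond to larger subalgebras of its power set. -/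
def setoidSubalgebraIso (α : Type*) [Finite α] :
    (Setoid α)ᵒᵈ ≃o BooleanSubalgebra (Set α) where
  toFun r := subalgebraOfSupCompl
    {S | ∀ x y, (OrderDual.ofDual r) x y → x ∈ S → y ∈ S} (fun _ _ _ h => h)
    (fun _ ha _ hb x y h hx => hx.imp (ha x y h) (hb x y h))
    (fun _ ha x y h hx hy => hx (ha y x (Setoid.symm' _ h) hy))
  invFun A := OrderDual.toDual
    { r := fun x y => ∀ S ∈ A, x ∈ S → y ∈ S
      iseqv := ⟨fun _ _ _ h => h,
        fun h S hS hy => by_contra fun hx => h Sᶜ (A.compl_mem hS) hx hy,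
        fun h h' S hS hx => h' S hS (h S hS hx)⟩ }
  left_inv r := by
    refine OrderDual.ofDual.injective (Setoid.ext fun x y => ⟨fun h => ?_, fun h S hS => ?_⟩)
    · exact h {z | (OrderDual.ofDual r) x z} (fun _ _ h h' => Setoid.trans' _ h' h)
        (Setoid.refl' _ x)
    · exact hS x y h
  right_inv A := by
    refine SetLike.ext fun S => ⟨fun h => ?_, fun hS x y h => h S hS⟩
    -- S is the union of the least members of A around its points; both operations are finite, so
    -- they stay in A.
    have hSU : S = ⨆ x ∈ S, ⨅ T ∈ {T | T ∈ A ∧ x ∈ T}, T := by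
      ext y
      simp only [Set.iSup_eq_iUnion, Set.iInf_eq_iInter, Set.mem_iUnion, Set.mem_iInter]
      refine ⟨fun hy => ⟨y, hy, fun T hT => hT.2⟩, ?_⟩
      rintro ⟨x, hx, hT⟩
      exact h x y (fun T hTA hxT => hT T ⟨hTA, hxT⟩) hx
    rw [hSU]
    exact BooleanSubalgebra.biSup_mem S.toFinite fun x _ =>
      BooleanSubalgebra.biInf_mem (Set.toFinite _) fun T hT => hT.1
  map_rel_iff' {r s} := by
    constructor
    · intro h x y hxy
      exact (show {z | (OrderDual.ofDual r) x z} ∈ _ from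
        h (fun _ _ h h' => Setoid.trans' _ h' h)) x y hxy (Setoid.refl' _ x)
    · intro h S hS x y hxy
      exact hS x y (h hxy)

/-- The lattice of partitions of a finite set, with finer partitions above coarser ones, is the
lattice of subalgebras of its power set. -/
def partitionsSubalgebraIso (α : Type*) [Finite α] :
    (Setoid.Partitions α)ᵒᵈ ≃o BooleanSubalgebra (Set α) :=
  (Setoid.Partition.orderIso α).symm.dual.trans (setoidSubalgebraIso α)

theorem exists_orderIso_set_fin (B : Type*) [BooleanAlgebra B] [Finite B] :
    ∃ n : ℕ, Nonempty (B ≃o Set (Fin n)) := by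
  cases nonempty_fintype B
  let _ : CompleteBooleanAlgebra B := Fintype.toCompleteBooleanAlgebra B
  let _ : CompleteAtomicBooleanAlgebra B := CompleteBooleanAlgebra.toCompleteAtomicBooleanAlgebra
  obtain ⟨n, ⟨e⟩⟩ := Finite.exists_equiv_fin {a : B // IsAtom a}
  exact ⟨n, ⟨CompleteAtomicBooleanAlgebra.toSetOfIsAtom.trans e.toOrderIsoSet⟩⟩

theorem exists_finite_subalgebra {s : Set B} (hs : s.Finite) :
    ∃ S : BooleanSubalgebra B, (S : Set B).Finite ∧ s ⊆ S := by
  induction s, hs using Set.Finite.induction_on with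
  | empty => exact ⟨⊥, by simp, Set.empty_subset _⟩
  | @insert p s _ _ ih =>
    obtain ⟨S, hS, hsS⟩ := ih
    exact ⟨adjoin S p, adjoin_finite hS p,
      Set.insert_subset (self_mem_adjoin S p) (hsS.trans (le_adjoin S p))⟩

theorem mem_sSup_of_directedOn {s : Set (BooleanSubalgebra B)} (hne : s.Nonempty)
    (hs : DirectedOn (· ≤ ·) s) {b : B} : b ∈ sSup s ↔ ∃ S ∈ s, b ∈ S := by
  refine ⟨fun hb => ?_, fun ⟨S, hS, hb⟩ => (le_sSup hS : S ≤ _) hb⟩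
  let T : BooleanSubalgebra B := subalgebraOfSupCompl {b | ∃ S ∈ s, b ∈ S}
    (hne.imp fun S hS => ⟨hS, S.bot_mem⟩)
    (by
      rintro x ⟨S, hS, hx⟩ y ⟨S', hS', hy⟩
      obtain ⟨U, hU, hSU, hSU'⟩ := hs S hS S' hS'
      exact ⟨U, hU, U.sup_mem (hSU hx) (hSU' hy)⟩)
    (by
      rintro x ⟨S, hS, hx⟩
      exact ⟨S, hS, S.compl_mem hx⟩)
  exact (sSup_le fun S hS x hx => ⟨S, hS, hx⟩ : sSup s ≤ T) hb

theorem isCompactElement_gen (b : B) : IsCompactElement (gen b) := by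
  rw [CompleteLattice.isCompactElement_iff_le_of_directed_sSup_le]
  intro s hne hs hb
  obtain ⟨S, hS, hbS⟩ := (mem_sSup_of_directedOn hne hs).1 (gen_le_iff.1 hb)
  exact ⟨S, hS, gen_le_iff.2 hbS⟩

/-- B is the directed union of its finite subalgebras, so a compact S lies in one of them. -/
theorem finite_of_isCompactElement {S : BooleanSubalgebra B} (hS : IsCompactElement S) :
    (S : Set B).Finite := by
  let s : Set (BooleanSubalgebra B) := {T | (T : Set B).Finite}
  have hne : s.Nonempty := ⟨⊥, by simp [s]⟩
  have hs : DirectedOn (· ≤ ·) s := by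
    intro T hT T' hT'
    obtain ⟨U, hU, hTU⟩ := exists_finite_subalgebra (Set.Finite.union hT hT')
    exact ⟨U, hU, Set.subset_union_left.trans hTU, Set.subset_union_right.trans hTU⟩
  have hle : S ≤ sSup s := fun b _ => by
    obtain ⟨U, hU, hbU⟩ := exists_finite_subalgebra (Set.finite_singleton b)
    exact (mem_sSup_of_directedOn hne hs).2 ⟨U, hU, hbU rfl⟩
  obtain ⟨T, hT, hST⟩ :=
    (CompleteLattice.isCompactElement_iff_le_of_directed_sSup_le _ S).1 hS s hne hs hle
  exact Set.Finite.subset hT hST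

theorem isBooleanDomain_subalgebra (B : Type*) [BooleanAlgebra B] :
    IsBooleanDomain (BooleanSubalgebra B) where
  algebraic := ⟨fun S => ⟨gen '' S, by
    rintro _ ⟨b, -, rfl⟩
    exact isCompactElement_gen b, le_antisymm (sSup_le (by
      rintro _ ⟨b, hb, rfl⟩
      exact gen_le_iff.2 hb)) fun b hb => gen_le_iff.1 (le_sSup ⟨b, hb, rfl⟩)⟩⟩
  partition S hS := by
    have : Finite S := finite_of_isCompactElement hS
    obtain ⟨n, ⟨e⟩⟩ := exists_orderIso_set_fin S
    exact ⟨n, ⟨(subalgebraIicIso S).symm.trans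
      ((subalgebraCongr e).trans (partitionsSubalgebraIso (Fin n)).symm)⟩⟩

end Finite

/-! ### Direct limits of Boolean algebras -/

section Limit

variable {ι : Type*} [Preorder ι] [IsDirectedOrder ι] {F : ι → Type*}
  [∀ i, BooleanAlgebra (F i)] (f : ∀ i j, i ≤ j → BoundedLatticeHom (F i) (F j))
  [DirectedSystem F (f · · ·)]

/-- The join in a direct limit of Boolean algebras. -/
noncomputable def limitSup : DirectLimit F f → DirectLimit F f → DirectLimit F f :=
  DirectLimit.map₂ f f f (fun _ a b => a ⊔ b) fun i j h x y => map_sup (f i j h) x y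

/-- The meet in a direct limit of Boolean algebras. -/
noncomputable def limitInf : DirectLimit F f → DirectLimit F f → DirectLimit F f :=
  DirectLimit.map₂ f f f (fun _ a b => a ⊓ b) fun i j h x y => map_inf (f i j h) x y

/-- The complement in a direct limit of Boolean algebras. -/
def limitCompl : DirectLimit F f → DirectLimit F f :=
  DirectLimit.map f f (fun _ a => aᶜ) fun i j h x => map_compl' (f i j h) x

theorem limitSup_mk (i : ι) (a b : F i) :
    limitSup f ⟦⟨i, a⟩⟧ ⟦⟨i, b⟩⟧ = ⟦⟨i, a ⊔ b⟩⟧ := DirectLimit.map₂_def ..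

theorem limitInf_mk (i : ι) (a b : F i) :
    limitInf f ⟦⟨i, a⟩⟧ ⟦⟨i, b⟩⟧ = ⟦⟨i, a ⊓ b⟩⟧ := DirectLimit.map₂_def ..

theorem limitCompl_mk (i : ι) (a : F i) : limitCompl f ⟦⟨i, a⟩⟧ = ⟦⟨i, aᶜ⟩⟧ := rfl

variable [Nonempty ι]

theorem limitBot_mk (i : ι) : DirectLimit.map₀ f (fun _ => ⊥) = ⟦⟨i, ⊥⟩⟧ :=
  DirectLimit.map₀_def f _ (fun i j h => map_bot (f i j h)) i

theorem limitTop_mk (i : ι) : DirectLimit.map₀ f (fun _ => ⊤) = ⟦⟨i, ⊤⟩⟧ :=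
  DirectLimit.map₀_def f _ (fun i j h => map_top (f i j h)) i

/-- The lattice structure on a direct limit of Boolean algebras. -/
noncomputable abbrev limitLattice : Lattice (DirectLimit F f) :=
  @Lattice.mk' _ ⟨limitSup f⟩ ⟨limitInf f⟩
    (DirectLimit.induction₂ _ fun i a b =>
      show limitSup f _ _ = limitSup f _ _ by simp only [limitSup_mk, sup_comm])
    (DirectLimit.induction₃ _ fun i a b c =>
      show limitSup f (limitSup f _ _) _ = limitSup f _ (limitSup f _ _) by
        simp only [limitSup_mk, sup_assoc])
    (DirectLimit.induction₂ _ fun i a b =>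
      show limitInf f _ _ = limitInf f _ _ by simp only [limitInf_mk, inf_comm])
    (DirectLimit.induction₃ _ fun i a b c =>
      show limitInf f (limitInf f _ _) _ = limitInf f _ (limitInf f _ _) by
        simp only [limitInf_mk, inf_assoc])
    (DirectLimit.induction₂ _ fun i a b =>
      show limitSup f _ (limitInf f _ _) = _ by
        simp only [limitInf_mk, limitSup_mk, sup_inf_self])
    (DirectLimit.induction₂ _ fun i a b =>
      show limitInf f _ (limitSup f _ _) = _ by
        simp only [limitInf_mk, limitSup_mk, inf_sup_self])

/-- The Boolean algebra structure on a direct limit of Boolean algebras. -/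
noncomputable abbrev limitBooleanAlgebra : BooleanAlgebra (DirectLimit F f) :=
  letI := limitLattice f
  -- The order built by `Lattice.mk'` is a ⊔ b = b, so each inequality is an identity to be checked
  -- at a single stage.
  { DistribLattice.ofInfSupLe (α := DirectLimit F f) (DirectLimit.induction₃ _ fun i a b c =>
      show limitSup f (limitInf f _ (limitSup f _ _)) (limitSup f (limitInf f _ _)
          (limitInf f _ _)) = limitSup f (limitInf f _ _) (limitInf f _ _) by
        simp only [limitInf_mk, limitSup_mk, inf_sup_left, sup_idem]) with
    compl := limitCompl f
    bot := DirectLimit.map₀ f fun _ => ⊥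
    top := DirectLimit.map₀ f fun _ => ⊤
    inf_compl_le_bot := DirectLimit.induction _ fun i a =>
      show limitSup f (limitInf f _ (limitCompl f _)) (DirectLimit.map₀ f fun _ => ⊥) =
          DirectLimit.map₀ f fun _ => ⊥ by
        simp only [limitBot_mk f i, limitInf_mk, limitSup_mk, limitCompl_mk, inf_compl_eq_bot,
          sup_idem]
    top_le_sup_compl := DirectLimit.induction _ fun i a =>
      show limitSup f (DirectLimit.map₀ f fun _ => ⊤) (limitSup f _ (limitCompl f _)) =
          limitSup f _ (limitCompl f _) by
        simp only [limitTop_mk f i, limitSup_mk, limitCompl_mk, sup_compl_eq_top, sup_idem]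
    le_top := DirectLimit.induction _ fun i a =>
      show limitSup f _ (DirectLimit.map₀ f fun _ => ⊤) = DirectLimit.map₀ f fun _ => ⊤ by
        simp only [limitTop_mk f i, limitSup_mk, sup_top_eq]
    bot_le := DirectLimit.induction _ fun i a =>
      show limitSup f (DirectLimit.map₀ f fun _ => ⊥) _ = _ by
        simp only [limitBot_mk f i, limitSup_mk, bot_sup_eq]
    sdiff_eq := fun _ _ => rfl
    himp_eq := fun _ _ => rfl }

end Limit

/-! ### Embeddings inducing inclusions of principal ideals -/

section Transition

variable {X : Type*} [CompleteLattice X] {B C D : Type*} [BooleanAlgebra B] [BooleanAlgebra C]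
  [BooleanAlgebra D] {k l m : X} {φ : Set.Iic k ≃o BooleanSubalgebra B}
  {ψ : Set.Iic l ≃o BooleanSubalgebra C} {χ : Set.Iic m ≃o BooleanSubalgebra D}

/-- An embedding of Boolean algebras that induces the inclusion of an ideal `Iic k` in an ideal
`Iic l`, when these are identified with the lattices of subalgebras of the algebras. -/
structure IsTransition (hkl : k ≤ l) (φ : Set.Iic k ≃o BooleanSubalgebra B)
    (ψ : Set.Iic l ≃o BooleanSubalgebra C) (f : BoundedLatticeHom B C) : Prop where
  injective : Function.Injective f
  exists_eq : ∀ c ∈ ψ ⟨k, hkl⟩, ∃ b, f b = c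
  mem_iff : ∀ (x : X) (hx : x ≤ k) (b : B), f b ∈ ψ ⟨x, hx.trans hkl⟩ ↔ b ∈ φ ⟨x, hx⟩

theorem isTransition_id (φ : Set.Iic k ≃o BooleanSubalgebra B) :
    IsTransition le_rfl φ φ (BoundedLatticeHom.id B) :=
  ⟨fun _ _ h => h, fun c _ => ⟨c, rfl⟩, fun _ _ _ => Iff.rfl⟩

theorem IsTransition.comp {hkl : k ≤ l} {hlm : l ≤ m} {f : BoundedLatticeHom B C}
    {g : BoundedLatticeHom C D} (hf : IsTransition hkl φ ψ f) (hg : IsTransition hlm ψ χ g) :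
    IsTransition (hkl.trans hlm) φ χ (g.comp f) := by
  refine ⟨hg.injective.comp hf.injective, fun c hc => ?_, fun x hx b => ?_⟩
  · have hle : χ ⟨k, hkl.trans hlm⟩ ≤ χ ⟨l, hlm⟩ := χ.le_iff_le.2 hkl
    obtain ⟨c, rfl⟩ := hg.exists_eq c (hle hc)
    obtain ⟨b, rfl⟩ := hf.exists_eq c ((hg.mem_iff k hkl c).1 hc)
    exact ⟨b, rfl⟩
  · rw [← hf.mem_iff x hx, ← hg.mem_iff x (hx.trans hkl)]
    rfl

theorem isBasic_Iic_top_iff : IsBasic (⊤ : Set.Iic k) ↔ IsBasic k := by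
  have h : IsAtom (⊤ : Set.Iic k) ↔ IsAtom k := by
    constructor
    · intro h
      refine ⟨fun hk => h.1 (Subtype.ext hk), fun b hb => ?_⟩
      exact congrArg Subtype.val (h.2 ⟨b, hb.le⟩ hb)
    · intro h
      refine ⟨fun hk => h.1 (congrArg Subtype.val hk), fun b hb => Subtype.ext (h.2 b hb)⟩
  rw [IsBasic, IsBasic, h, Subtype.ext_iff]
  rfl

/-- At the x ≤ k corresponding to `gen b`, f b lies in the subalgebra of x, which g also fills from
`gen b`. Rigidity then applies. -/
theorem IsTransition.unique {hkl : k ≤ l} (hk : ¬ IsBasic k) {f g : BoundedLatticeHom B C}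
    (hf : IsTransition hkl φ ψ f) (hg : IsTransition hkl φ ψ g) : f = g := by
  refine eq_of_forall_mem_gen ?_ hf.injective hg.injective fun b => ?_
  · rwa [← map_top φ, isBasic_map_iff, isBasic_Iic_top_iff]
  · obtain ⟨⟨x, hx⟩, hxb⟩ := φ.surjective (gen b)
    have h := (hf.mem_iff x hx b).2 (hxb ▸ self_mem_gen b)
    have hle : ψ ⟨x, hx.trans hkl⟩ ≤ ψ ⟨k, hkl⟩ := ψ.le_iff_le.2 hx
    obtain ⟨c, hc⟩ := hg.exists_eq _ (hle h)
    refine ⟨c, ?_, hc.symm⟩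
    rw [← hxb]
    exact (hg.mem_iff x hx c).1 (hc ▸ h)

theorem exists_isTransition (hkl : k ≤ l) (hk : ¬ IsBasic k)
    (φ : Set.Iic k ≃o BooleanSubalgebra B) (ψ : Set.Iic l ≃o BooleanSubalgebra C) :
    ∃ f, IsTransition hkl φ ψ f := by
  let e : Set.Iic k ≃o Set.Iic (ψ ⟨k, hkl⟩) :=
    { toFun x := ⟨ψ ⟨x, x.2.trans hkl⟩, ψ.le_iff_le.2 x.2⟩
      invFun S := ⟨ψ.symm S, ψ.symm_apply_le.2 S.2⟩
      left_inv x := by simp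
      right_inv S := Subtype.ext (ψ.apply_symm_apply S)
      map_rel_iff' {x y} := ψ.le_iff_le }
  have hB : ¬ IsBasic (⊤ : BooleanSubalgebra B) := by
    rwa [← map_top φ, isBasic_map_iff, isBasic_Iic_top_iff]
  obtain ⟨f, hf, hr, h⟩ := exists_hom_of_subalgebraIso hB (φ.symm.trans e)
  refine ⟨f, hf, fun c hc => ?_, fun x hx b => ?_⟩
  · have : c ∈ Set.range f := hr ▸ hc
    exact this
  · rw [← h]
    simp [e]

/-- The least element of X whose subalgebra contains b does not change along a transition, so it is
well defined on the direct limit. -/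
theorem IsTransition.coe_symm_gen {hkl : k ≤ l} {f : BoundedLatticeHom B C}
    (hf : IsTransition hkl φ ψ f) (b : B) :
    ((ψ.symm (gen (f b)) : Set.Iic l) : X) = (φ.symm (gen b) : Set.Iic k) := by
  have h1 : ((ψ.symm (gen (f b)) : Set.Iic l) : X) ≤ (φ.symm (gen b) : Set.Iic k) := by
    have h := (hf.mem_iff _ (φ.symm (gen b)).2 b).2 (by simp [self_mem_gen])
    exact ψ.symm_apply_le.2 (gen_le_iff.2 h)
  refine le_antisymm h1 ?_
  have hle := h1.trans (φ.symm (gen b)).2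
  have h := (hf.mem_iff _ hle b).1
    (show f b ∈ ψ (ψ.symm (gen (f b))) by rw [ψ.apply_symm_apply]; exact self_mem_gen _)
  exact φ.symm_apply_le.2 (gen_le_iff.2 h)

end Transition

/-! ### Every Boolean domain with more than two elements is some Sub(B) -/

section Representation

variable {X : Type v} [CompleteLattice X]

theorem IsBooleanDomain.exists_subalgebraIso (hX : IsBooleanDomain X) {k : X}
    (hk : IsCompactElement k) : ∃ n : ℕ, Nonempty (Set.Iic k ≃o BooleanSubalgebra (Set (Fin n))) := by
  obtain ⟨n, ⟨e⟩⟩ := hX.partition k hk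
  exact ⟨n, ⟨e.trans (partitionsSubalgebraIso (Fin n))⟩⟩

/-- The ideal below k is finite, so x is a finite join of compact elements. -/
theorem IsBooleanDomain.isCompactElement_of_le (hX : IsBooleanDomain X) {x k : X}
    (hk : IsCompactElement k) (hx : x ≤ k) : IsCompactElement x := by
  obtain ⟨n, ⟨e⟩⟩ := hX.exists_subalgebraIso hk
  have : Finite (BooleanSubalgebra (Set (Fin n))) := Finite.of_injective _ SetLike.coe_injective
  have hfin : Finite (Set.Iic k) := Finite.of_injective _ e.injective
  obtain ⟨s, hs, rfl⟩ := hX.algebraic.exists_sSup_eq x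
  have hsf : s.Finite := (Set.toFinite (Set.Iic k)).subset fun y hy => (le_sSup hy).trans hx
  have h := CompleteLattice.isCompactElement_finsetSup (f := id) hsf.toFinset
    fun y hy => hs y (hsf.mem_toFinset.1 hy)
  rwa [Finset.sup_id_eq_sSup, hsf.coe_toFinset] at h

theorem isCompactElement_sup {x y : X} (hx : IsCompactElement x) (hy : IsCompactElement y) :
    IsCompactElement (x ⊔ y) := by
  classical
  have h := CompleteLattice.isCompactElement_finsetSup (f := id) {x, y} (by
    intro z hz
    rcases Finset.mem_insert.1 hz with rfl | hz
    · exact hx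
    · exact Finset.mem_singleton.1 hz ▸ hy)
  simpa using h

theorem IsBooleanDomain.le_of_forall_compact (hX : IsBooleanDomain X) {x y : X}
    (h : ∀ c, IsCompactElement c → c ≤ x → c ≤ y) : x ≤ y := by
  obtain ⟨s, hs, rfl⟩ := hX.algebraic.exists_sSup_eq x
  exact sSup_le fun c hc => h c (hs c hc) (le_sSup hc)

/-- If all compact elements were basic, then for a compact atom a and any compact c the join a ⊔ c
would be basic, so c ≤ a; thus ⊤ = a. -/
theorem IsBooleanDomain.exists_compact_not_isBasic (hX : IsBooleanDomain X)
    (hX2 : ¬ IsBasic (⊤ : X)) : ∃ k : X, IsCompactElement k ∧ ¬ IsBasic k := by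
  by_contra! hall
  have h1 : ¬ (⊤ : X) ≤ ⊥ := fun h => hX2 (Or.inl (le_bot_iff.1 h))
  obtain ⟨a, ha, ha0⟩ : ∃ a : X, IsCompactElement a ∧ a ≠ ⊥ := by
    by_contra! h
    exact h1 (hX.le_of_forall_compact fun c hc _ => (h c hc).le)
  have haa : IsAtom a := (hall a ha).resolve_left ha0
  have h2 : ¬ (⊤ : X) ≤ a := fun h => hX2 (Or.inr (top_le_iff.1 h ▸ haa))
  refine h2 (hX.le_of_forall_compact fun c hc _ => ?_)
  rcases hall _ (isCompactElement_sup ha hc) with h | h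
  · exact (le_sup_right.trans h.le).trans bot_le
  · rcases h.le_iff.1 (le_sup_left : a ≤ a ⊔ c) with h | h
    · exact (ha0 h).elim
    · exact h ▸ le_sup_right

theorem not_isBasic_of_le {k l : X} (hk : ¬ IsBasic k) (h : k ≤ l) : ¬ IsBasic l := by
  rintro (rfl | hl)
  · exact hk (Or.inl (le_bot_iff.1 h))
  · rcases hl.le_iff.1 h with rfl | rfl
    exacts [hk (Or.inl rfl), hk (Or.inr hl)]

/-- Every Boolean domain with more than two elements is the lattice of subalgebras of a Boolean
algebra. -/
theorem IsBooleanDomain.exists_orderIso_subalgebra (hX : IsBooleanDomain X)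
    (hX2 : ¬ IsBasic (⊤ : X)) :
    ∃ (B : Type v) (_ : BooleanAlgebra B), Nonempty (X ≃o BooleanSubalgebra B) := by
  obtain ⟨k₀, hk₀, hb₀⟩ := hX.exists_compact_not_isBasic hX2
  -- Staying above a nonbasic k₀ keeps every index nonbasic, as uniqueness of transitions requires,
  -- and is still cofinal among the compact elements.
  let ι : Type v := {k : X // IsCompactElement k ∧ k₀ ≤ k}
  have : Nonempty ι := ⟨⟨k₀, hk₀, le_rfl⟩⟩
  have : IsDirectedOrder ι := ⟨fun a b => ⟨⟨a.1 ⊔ b.1, isCompactElement_sup a.2.1 b.2.1,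
    a.2.2.trans le_sup_left⟩, le_sup_left (a := a.1), le_sup_right (a := a.1)⟩⟩
  have hb : ∀ k : ι, ¬ IsBasic k.1 := fun k => not_isBasic_of_le hb₀ k.2.2
  choose n hn using fun k : ι => hX.exists_subalgebraIso k.2.1
  let φ : ∀ k : ι, Set.Iic k.1 ≃o BooleanSubalgebra (Set (Fin (n k))) := fun k => (hn k).some
  choose f hf using fun (k l : ι) (h : k ≤ l) => exists_isTransition h (hb k) (φ k) (φ l)
  have : DirectedSystem (fun k : ι => Set (Fin (n k))) (f · · ·) :=
    { map_self := fun k x => by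
        rw [(hf k k le_rfl).unique (hb k) (isTransition_id (φ k))]
        rfl
      map_map := fun l k j hjk hkl x => by
        rw [← ((hf j k hjk).comp (hf k l hkl)).unique (hb j) (hf j l (hjk.trans hkl))]
        rfl }
  let B : Type v := DirectLimit (fun k : ι => Set (Fin (n k))) f
  let instB : BooleanAlgebra B := limitBooleanAlgebra f
  let mk : ∀ k : ι, Set (Fin (n k)) → B := fun k a => ⟦⟨k, a⟩⟧
  have mk_map : ∀ (k l : ι) (h : k ≤ l) (a : Set (Fin (n k))), mk l (f k l h a) = mk k a :=
    fun k l h a => DirectLimit.mk_apply (f := f) k l a h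
  have mk_sup : ∀ k a b, mk k a ⊔ mk k b = mk k (a ⊔ b) := fun k a b => limitSup_mk f k a b
  have mk_compl : ∀ k a, (mk k a)ᶜ = mk k aᶜ := fun k a => limitCompl_mk f k a
  have mk_bot : ∀ k, ⊥ = mk k ⊥ := fun k => limitBot_mk f k
  -- m b is the element of X that is to correspond to the subalgebra generated by b.
  let m : B → X := DirectLimit.lift f (fun k a => ((φ k).symm (gen a) : Set.Iic k.1))
    fun k l h a => ((hf k l h).coe_symm_gen a).symm
  have m_mk : ∀ k a, m (mk k a) = ((φ k).symm (gen a) : Set.Iic k.1) := fun k a => rfl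
  have m_mk_le : ∀ k a x, m (mk k a) ≤ x ↔ a ∈ φ k ⟨x ⊓ k.1, inf_le_right⟩ := by
    intro k a x
    rw [m_mk, ← gen_le_iff, ← (φ k).symm_apply_le, ← Subtype.coe_le_coe]
    exact ⟨fun h => le_inf h ((φ k).symm (gen a)).2, fun h => h.trans inf_le_left⟩
  let F : X → BooleanSubalgebra B := fun x => subalgebraOfSupCompl {b | m b ≤ x}
    (by
      obtain ⟨k⟩ := ‹Nonempty ι›
      change m ⊥ ≤ x
      rw [mk_bot k, m_mk_le]
      exact BooleanSubalgebra.bot_mem)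
    (by
      intro a ha b hb
      obtain ⟨k, a, b, rfl, rfl⟩ := DirectLimit.exists_eq_mk₂ f a b
      change m (mk k a ⊔ mk k b) ≤ x
      rw [mk_sup, m_mk_le]
      exact BooleanSubalgebra.sup_mem ((m_mk_le _ _ _).1 ha) ((m_mk_le _ _ _).1 hb))
    (by
      intro a ha
      obtain ⟨k, a, rfl⟩ := DirectLimit.exists_eq_mk f a
      change m (mk k a)ᶜ ≤ x
      rw [mk_compl, m_mk_le]
      exact BooleanSubalgebra.compl_mem ((m_mk_le _ _ _).1 ha))
  have mem_F : ∀ b x, b ∈ F x ↔ m b ≤ x := fun _ _ => Iff.rfl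
  have F_le : ∀ x y, F x ≤ F y ↔ x ≤ y := by
    refine fun x y => ⟨fun h => hX.le_of_forall_compact fun c hc hcx => ?_,
      fun h b hb => le_trans hb h⟩
    let k : ι := ⟨c ⊔ k₀, isCompactElement_sup hc hk₀, le_sup_right⟩
    have hle : φ k ⟨c, le_sup_left⟩ ≤ φ k ⟨y ⊓ k.1, inf_le_right⟩ := fun a ha => by
      refine (m_mk_le k a y).1 (h ?_)
      rw [mem_F, m_mk_le]
      exact (φ k).le_iff_le.2 (Subtype.coe_le_coe.1 (le_inf hcx le_sup_left)) ha
    exact (Subtype.coe_le_coe.2 ((φ k).le_iff_le.1 hle)).trans inf_le_left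
  have F_surj : Function.Surjective F := by
    intro S
    let S' : ∀ k : ι, BooleanSubalgebra (Set (Fin (n k))) := fun k =>
      subalgebraOfSupCompl {a | mk k a ∈ S} (by
          change mk k ⊥ ∈ S
          rw [← mk_bot]
          exact S.bot_mem)
        (fun a ha b hb => by
          change mk k (a ⊔ b) ∈ S
          rw [← mk_sup]
          exact S.sup_mem ha hb)
        (fun a ha => by
          change mk k aᶜ ∈ S
          rw [← mk_compl]
          exact S.compl_mem ha)
    have mem_S' : ∀ k a, a ∈ S' k ↔ mk k a ∈ S := fun _ _ => Iff.rfl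
    -- x k encodes the part of S visible at stage k; the supremum of these increasing elements is
    -- the preimage of S.
    let x : ι → X := fun k => ((φ k).symm (S' k) : Set.Iic k.1)
    have hxk : ∀ k, x k ≤ k.1 := fun k => ((φ k).symm (S' k)).2
    have x_mono : ∀ k l, k ≤ l → x k ≤ x l := by
      intro k l hkl
      have hle : φ l ⟨x k, (hxk k).trans hkl⟩ ≤ S' l := by
        intro c hc
        have hc' : c ∈ φ l ⟨k.1, hkl⟩ := (φ l).le_iff_le.2 (Subtype.coe_le_coe.1 (hxk k)) hc
        obtain ⟨a, rfl⟩ := (hf k l hkl).exists_eq c hc'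
        rw [mem_S', mk_map, ← mem_S']
        have ha := ((hf k l hkl).mem_iff _ (hxk k) a).1 hc
        change a ∈ φ k ((φ k).symm (S' k)) at ha
        rwa [(φ k).apply_symm_apply] at ha
      exact Subtype.coe_le_coe.2 ((φ l).le_symm_apply.2 hle)
    have mem_iff : ∀ k a, m (mk k a) ≤ x k ↔ mk k a ∈ S := by
      intro k a
      rw [← mem_S', ← gen_le_iff, m_mk]
      exact (φ k).symm.le_iff_le
    refine ⟨⨆ k, x k, SetLike.ext fun b => ?_⟩
    obtain ⟨k, a, rfl⟩ := DirectLimit.exists_eq_mk f b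
    change mk k a ∈ F (⨆ k, x k) ↔ mk k a ∈ S
    rw [mem_F]
    constructor
    · intro h
      -- Compactness brings the bound by the directed supremum down to one stage.
      have hc : IsCompactElement (m (mk k a)) :=
        hX.isCompactElement_of_le k.2.1 ((φ k).symm (gen a)).2
      obtain ⟨_, ⟨l, rfl⟩, hl⟩ :=
        (CompleteLattice.isCompactElement_iff_le_of_directed_sSup_le _ _).1 hc (Set.range x)
          (Set.range_nonempty x) (by
            rintro _ ⟨i, rfl⟩ _ ⟨j, rfl⟩
            obtain ⟨l, hil, hjl⟩ := exists_ge_ge i j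
            exact ⟨x l, ⟨l, rfl⟩, x_mono i l hil, x_mono j l hjl⟩) h
      obtain ⟨j, hkj, hlj⟩ := exists_ge_ge k l
      rw [← mk_map k j hkj, ← mem_iff, mk_map]
      exact hl.trans (x_mono l j hlj)
    · intro h
      exact ((mem_iff k a).2 h).trans (le_iSup x k)
  exact ⟨B, instB, ⟨OrderIso.ofSurjective (OrderEmbedding.ofMapLEIff F F_le) F_surj⟩⟩

end Representation

/-! ### Directions and transfer to Dir(X) and oDir(X) -/

section ODirections

variable {X : Type*} [CompleteLattice X] {B : Type*} [BooleanAlgebra B]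

/-- If p comes from b, the bound on y says that b lies in the subalgebra e y, and the traces of p on
e y are the principal subalgebras of b and bᶜ computed inside e y. -/
theorem isPrincipalPairFor_inf (e : X ≃o BooleanSubalgebra B) (p : Dir X) {y : X}
    (hy : p.fst ⊓ p.snd ≤ y) :
    IsPrincipalPairFor (⟨p.fst ⊓ p.snd, hy⟩ : Set.Iic y)
      ⟨y ⊓ p.fst, inf_le_left⟩ ⟨y ⊓ p.snd, inf_le_left⟩ := by
  obtain ⟨b, hb⟩ := toDir_surjective (Dir.congr e p)
  have h1 : e p.fst = principal b := (congrArg Dir.fst hb).symm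
  have h2 : e p.snd = principal bᶜ := (congrArg Dir.snd hb).symm
  have hbC : b ∈ e y := by
    rw [← gen_le_iff, ← principal_inf_principal_compl, ← h1, ← h2, ← map_inf]
    exact e.le_iff_le.2 hy
  let e' : Set.Iic y ≃o Set.Iic (e y) :=
    { toFun x := ⟨e x, e.le_iff_le.2 x.2⟩
      invFun S := ⟨e.symm S, e.symm_apply_le.2 S.2⟩
      left_inv x := by simp
      right_inv S := by simp
      map_rel_iff' {x y} := e.le_iff_le }
  let g : Set.Iic y ≃o BooleanSubalgebra (e y) := e'.trans (subalgebraIicIso (e y)).symm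
  have hg : ∀ x : Set.Iic y, ∀ c, c ∈ g x ↔ (c : B) ∈ e x := fun _ _ => Iff.rfl
  have key : ∀ (q : X) (c : B) (hc : c ∈ e y), e q = principal c →
      g ⟨y ⊓ q, inf_le_left⟩ = principal ⟨c, hc⟩ := fun q c hc h => SetLike.ext fun a => by
    rw [hg, map_inf, h, BooleanSubalgebra.mem_inf]
    exact ⟨fun ha => ha.2, fun ha => ⟨a.2, ha⟩⟩
  refine ⟨(isPrincipalPair_map_iff g).1 ?_, Subtype.ext ?_⟩
  · rw [key _ b hbC h1, key _ bᶜ (BooleanSubalgebra.compl_mem hbC) h2]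
    exact isPrincipalPair_principal (⟨b, hbC⟩ : e y)
  · change y ⊓ p.fst ⊓ (y ⊓ p.snd) = p.fst ⊓ p.snd
    rw [← inf_inf_distrib_left, inf_eq_right.2 hy]

theorem isBasic_fst_inf_snd (p : Dir X) : IsBasic (p.fst ⊓ p.snd) := by
  rcases p.isPrincipalPair.2.2 with ⟨h, hb⟩ | ⟨h, hb⟩ | ⟨-, hb, -⟩
  · rwa [h, top_inf_eq]
  · rwa [h, inf_top_eq]
  · exact hb

/-- The direction of a lattice of subalgebras determined by a principal pair. -/
def ODir.ofDir (e : X ≃o BooleanSubalgebra B) (p : Dir X) : ODir X where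
  base := p.fst ⊓ p.snd
  isBasic_base := isBasic_fst_inf_snd p
  toFun y := ((y : X) ⊓ p.fst, (y : X) ⊓ p.snd)
  isPrincipalPair y := ⟨_, _, rfl, isPrincipalPairFor_inf e p y.2⟩
  compat y z hyz := by
    have h : (y : X) ≤ z := hyz
    simp only [← inf_assoc, inf_eq_left.2 h]

theorem ODir.atTop_ofDir (e : X ≃o BooleanSubalgebra B) (p : Dir X) :
    (ODir.ofDir e p).atTop = p :=
  Dir.ext (top_inf_eq _) (top_inf_eq _)

theorem ODir.base_eq (d : ODir X) : d.base = d.atTop.fst ⊓ d.atTop.snd := by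
  obtain ⟨s, t, h, -, hx⟩ := d.isPrincipalPair ⟨⊤, le_top⟩
  have hx' : (s : X) ⊓ t = d.base := congrArg Subtype.val hx
  change _ = (d.toFun ⟨⊤, le_top⟩).1 ⊓ (d.toFun ⟨⊤, le_top⟩).2
  rw [h, hx']

theorem ODir.toFun_eq (d : ODir X) (y : Set.Ici d.base) :
    d.toFun y = ((y : X) ⊓ d.atTop.fst, (y : X) ⊓ d.atTop.snd) :=
  d.compat y ⟨⊤, le_top⟩ le_top

/-- Compatibility with z = ⊤ expresses every value through d(⊤), and the base is the meet of its
components. -/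
theorem ODir.atTop_injective : Function.Injective (ODir.atTop (X := X)) := by
  intro d e h
  have hbase : d.base = e.base := by rw [d.base_eq, e.base_eq, h]
  have hfun : ∀ (y : X) (hd : d.base ≤ y) (he : e.base ≤ y), d.toFun ⟨y, hd⟩ = e.toFun ⟨y, he⟩ :=
    fun y hd he => by rw [d.toFun_eq, e.toFun_eq, h]
  obtain ⟨b, _, f, _, _⟩ := d
  obtain ⟨b', _, f', _, _⟩ := e
  obtain rfl : b = b' := hbase
  obtain rfl : f = f' := funext fun y => hfun y y.2 y.2
  rfl

theorem ODir.atTop_bijective (e : X ≃o BooleanSubalgebra B) :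
    Function.Bijective (ODir.atTop (X := X)) :=
  ⟨ODir.atTop_injective, fun p => ⟨ODir.ofDir e p, ODir.atTop_ofDir e p⟩⟩

/-- A Boolean algebra is isomorphic to the set of principal pairs of each lattice isomorphic to
its lattice of subalgebras. -/
theorem exists_equiv_dir (e : X ≃o BooleanSubalgebra B) (hX : ¬ IsBasic (⊤ : X)) :
    ∃ f : B ≃ Dir X, (∀ a b : B, a ≤ b ↔ (f a).le (f b)) ∧ (∀ a : B, f aᶜ = (f a).compl) := by
  have hB : ¬ IsBasic (⊤ : BooleanSubalgebra B) := by rwa [← map_top e, isBasic_map_iff]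
  refine ⟨(equivDir hB).trans (Dir.congr e.symm), fun a b => ?_, fun a => ?_⟩
  · rw [le_iff_toDir_le hB]
    exact (Dir.congr_le_iff e.symm).symm
  · exact (congrArg (Dir.congr e.symm) (toDir_compl a)).trans (Dir.congr_compl e.symm (toDir a))

/-- A Boolean algebra is isomorphic to the set of directions of each lattice isomorphic to its
lattice of subalgebras. -/
theorem exists_equiv_oDir (e : X ≃o BooleanSubalgebra B) (hX : ¬ IsBasic (⊤ : X)) :
    ∃ f : B ≃ ODir X, (∀ a b : B, a ≤ b ↔ (f a).le (f b)) ∧ (∀ a : B, f aᶜ = (f a).compl) := by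
  obtain ⟨f, hle, hcompl⟩ := exists_equiv_dir e hX
  let g := Equiv.ofBijective _ (ODir.atTop_bijective e)
  have hg : ∀ a, (g.symm (f a)).atTop = f a := fun a => g.apply_symm_apply (f a)
  refine ⟨f.trans g.symm, fun a b => ?_, fun a => ODir.atTop_injective ?_⟩
  · change _ ↔ (g.symm (f a)).atTop.le (g.symm (f b)).atTop
    rw [hg, hg, hle]
  · change (g.symm (f aᶜ)).atTop = (g.symm (f a)).atTop.compl
    rw [hg, hg, hcompl]

theorem exists_booleanAlgebra_of_equiv {D : Type*} {le : D → D → Prop} {compl : D → D}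
    (e : X ≃o BooleanSubalgebra B)
    (h : ∃ f : B ≃ D, (∀ a b : B, a ≤ b ↔ le (f a) (f b)) ∧ (∀ a : B, f aᶜ = compl (f a))) :
    ∃ I : BooleanAlgebra D, (∀ p q, I.le p q ↔ le p q) ∧ (∀ p, I.compl p = compl p) ∧
      Nonempty (X ≃o BooleanSubalgebra D) := by
  obtain ⟨f, hle, hcompl⟩ := h
  let I : BooleanAlgebra D := f.symm.booleanAlgebra
  let g : B ≃o D := ⟨f, fun {a b} => by
    change f.symm (f a) ≤ f.symm (f b) ↔ a ≤ b
    rw [f.symm_apply_apply, f.symm_apply_apply]⟩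
  refine ⟨I, fun p q => ?_, fun p => ?_, ⟨e.trans (subalgebraCongr g)⟩⟩
  · change f.symm p ≤ f.symm q ↔ _
    rw [hle, f.apply_symm_apply, f.apply_symm_apply]
  · change f (f.symm p)ᶜ = _
    rw [hcompl, f.apply_symm_apply]

end ODirections

end BooleanDomain

theorem mainTheorem8 (B : Type u) [BooleanAlgebra B] (hB : 4 < ENat.card B)
    (X : Type v) [CompleteLattice X] (hX : BooleanDomain.IsBooleanDomain X)
    (hX2 : 2 < ENat.card X) :
    -- the subalgebra lattice of `B` is a Boolean domain
    BooleanDomain.IsBooleanDomain (BooleanSubalgebra B) ∧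
    -- `B` is isomorphic to `Dir (Sub B)` and to `ODir (Sub B)`
    (∃ f : B ≃ BooleanDomain.Dir (BooleanSubalgebra B),
      (∀ a b : B, a ≤ b ↔ (f a).le (f b)) ∧ (∀ a : B, f aᶜ = (f a).compl)) ∧
    (∃ f : B ≃ BooleanDomain.ODir (BooleanSubalgebra B),
      (∀ a b : B, a ≤ b ↔ (f a).le (f b)) ∧ (∀ a : B, f aᶜ = (f a).compl)) ∧
    -- `Dir X` is a Boolean algebra `D` under its order and complement, and `X ≅ Sub (Dir X)`
    (∃ D : BooleanAlgebra (BooleanDomain.Dir X),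
      (∀ p q, D.le p q ↔ p.le q) ∧ (∀ p, D.compl p = p.compl) ∧
      Nonempty (X ≃o BooleanSubalgebra (BooleanDomain.Dir X))) ∧
    -- `ODir X` is a Boolean algebra `D` under its order and complement, and `X ≅ Sub (ODir X)`
    (∃ D : BooleanAlgebra (BooleanDomain.ODir X),
      (∀ d e, D.le d e ↔ d.le e) ∧ (∀ d, D.compl d = d.compl) ∧
      Nonempty (X ≃o BooleanSubalgebra (BooleanDomain.ODir X))) ∧
    -- the map sending a direction `d` to `d(⊤)` identifies `ODir X` with `Dir X`
    (Function.Bijective (BooleanDomain.ODir.atTop : BooleanDomain.ODir X → BooleanDomain.Dir X) ∧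
      (∀ d e : BooleanDomain.ODir X, d.le e ↔ d.atTop.le e.atTop) ∧
      (∀ d : BooleanDomain.ODir X, d.compl.atTop = d.atTop.compl)) := by
  have hB' := BooleanDomain.not_isBasic_top_of_four_lt_card hB
  have hX' := BooleanDomain.not_isBasic_top_of_two_lt_card hX2
  obtain ⟨C, _, ⟨e⟩⟩ := hX.exists_orderIso_subalgebra hX'
  exact ⟨BooleanDomain.isBooleanDomain_subalgebra B,
    BooleanDomain.exists_equiv_dir (OrderIso.refl _) hB',
    BooleanDomain.exists_equiv_oDir (OrderIso.refl _) hB',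
    BooleanDomain.exists_booleanAlgebra_of_equiv e (BooleanDomain.exists_equiv_dir e hX'),
    BooleanDomain.exists_booleanAlgebra_of_equiv e (BooleanDomain.exists_equiv_oDir e hX'),
    BooleanDomain.ODir.atTop_bijective e, fun _ _ => Iff.rfl, fun _ => rfl⟩
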